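/- Let $\Lambda\subset(0,\infty)$ be finite or countable. For a metric space, its spectrum is the set of distances between distinct points. Let $\mathbb U=\mathbb U_\Lambda$ be the ultrametric Urysohn space: a complete separable ultrametric space with spectrum $\Lambda$ such that for all finite ultrametric spaces $X\subset Y$ with spectra contained in $\Lambda$ each isometric embedding $X\to\mathbb U$ extends to an isometric embedding $Y\to\mathbb U$. Let $\mathbb I=\mathbb I_\Lambda$ be the group of all isometries of $\mathbb U$ with the topology of pointwise convergence, and for a non-empty finite $X\subset\mathbb U$ let $\mathbb I[X]$ be its pointwise stabilizer. The amalgamation category $\mathcal K_\Lambda$ has as objects the non-empty finite ultrametric spaces with spectra contained in $\Lambda$. A morphism $\mathfrak p:X\to Y$ is a triple $(P,p_+,p_-)$, where $P$ is an ultrametric space with spectrum contained in $\Lambda$ and $p_+:X\to P$, $p_-:Y\to P$ are isometric embeddings with $p_+(X)\cup p_-(Y)=P$; two triples are equal as morphisms if there is an isometry $\pi$ of $P$ onto $P'$ with $p'_\pm=\pi\circ p_\pm$. For $\mathfrak p=(P,p_+,p_-):X\to Y$ and $\mathfrak q=(Q,q_+,q_-):Y\to Z$ let $P\Join Q$ be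 the disjoint union of $P$ and $Q$ with $p_-(y)$ and $q_+(y)$ identified for all $y\in Y$, equipped with the ultrametric that extends those of $P$ and $Q$ and is given by $d(a,b)=\min_{y\in Y}\max\bigl(d_P(a,p_-(y)),d_Q(q_+(y),b)\bigr)$ for $a\in P$, $b\in Q$. The product $\mathfrak q\diamond\mathfrak p:X\to Z$ is the triple consisting of the subspace $p_+(X)\cup q_-(Z)\subset P\Join Q$ and the maps $p_+$, $q_-$. The unit $1_X$ is $(X,\mathrm{id},\mathrm{id})$, and $(P,p_+,p_-)^*=(P,p_-,p_+)$. Let $\rho$ be a unitary representation of $\mathbb I$ in a complex Hilbert space $H$, i.e., a homomorphism to the unitary group of $H$ that is continuous in the strong operator topology. For a non-empty finite $X\subset\mathbb U$ let $H[X]$ be the subspace of $\mathbb I[X]$-fixed vectors and $\Pi[X]$ the orthogonal projection of $H$ to $H[X]$. For $g\in\mathbb I$ set $\widehat\rho_{X,Y}(g):=\Pi[Y]\,\rho(g)|_{H[X]}:H[X]\to H[Y]$. **Theorem.** For all non-empty finite $X,Y\subset\mathbb U$ the operator $\widehat\rho_{X,Y}(g)$ depends only on the double coset $\mathbb I[Y]\,g\,\mathbb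 I[X]$, and sending this double coset to the morphism $X\to Y$ given by $P=Y\cup g(X)$, $p_+=g|_X$ and the inclusion $p_-:Y\to P$ is a well-defined bijection $\mathbb I[Y]\backslash\mathbb I/\mathbb I[X]\to\operatorname{Mor}(X,Y)$. So $\widehat\rho_{X,Y}$ may be regarded as a function on $\operatorname{Mor}(X,Y)$, and the following holds for all non-empty finite $X,Y,Z\subset\mathbb U$. a) $\widehat\rho_{Y,Z}(\mathfrak q)\,\widehat\rho_{X,Y}(\mathfrak p)=\widehat\rho_{X,Z}(\mathfrak q\diamond\mathfrak p)$ for all $\mathfrak p\in\operatorname{Mor}(X,Y)$, $\mathfrak q\in\operatorname{Mor}(Y,Z)$. b) $\|\widehat\rho_{X,Y}(\mathfrak p)\|\le1$ for all $\mathfrak p\in\operatorname{Mor}(X,Y)$. c) $\widehat\rho_{X,Y}(\mathfrak p)^*=\widehat\rho_{Y,X}(\mathfrak p^*)$ for all $\mathfrak p\in\operatorname{Mor}(X,Y)$. d) $\widehat\rho_{X,Y}$ is continuous as a map from $\mathbb I[Y]\backslash\mathbb I/\mathbb I[X]$ with the quotient topology to the space of bounded operators $H[X]\to H[Y]$ with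 the weak operator topology. e) $\widehat\rho_{X,X}(1_X)=1_{H[X]}$. -/

import Mathlib

open CategoryTheory

universe u v

namespace UltraUrysohn

/-! ## Ultrametric Urysohn spaces -/

/-- The spectrum of a metric space: the set of all distances between distinct points. -/
def distSpectrum (A : Type u) [MetricSpace A] : Set ℝ :=
  {r | ∃ a b : A, a ≠ b ∧ dist a b = r}

/-- `U` is an ultrametric Urysohn space with spectrum `Λ`: a complete separable ultrametric
space with spectrum `Λ` such that every isometric embedding into `U` of a subspace `X` of a finite
ultrametric space `Y` with spectrum contained in `Λ` extends to an isometric embedding of `Y`. -/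
structure IsUrysohn (Λ : Set ℝ) (U : Type u) [MetricSpace U] : Prop where
  complete : CompleteSpace U
  separable : TopologicalSpace.SeparableSpace U
  ultrametric : IsUltrametricDist U
  spectrum_eq : distSpectrum U = Λ
  extension : ∀ (Y : Type u) [MetricSpace Y] [IsUltrametricDist Y] [Finite Y],
    distSpectrum Y ⊆ Λ → ∀ (X : Set Y) (f : X → U), Isometry f →
      ∃ g : Y → U, Isometry g ∧ ∀ x : X, g x = f x

/-! ## The amalgamation category -/

/-- Objects: finite (non-empty) ultrametric spaces with spectrum contained in `Λ`. -/
structure FinUltra (Λ : Set ℝ) : Type (u + 1) where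
  carrier : Type u
  [metric : MetricSpace carrier]
  [ultra : IsUltrametricDist carrier]
  [fin : Finite carrier]
  [nonempty : Nonempty carrier]
  spectrum_subset : distSpectrum carrier ⊆ Λ

attribute [instance] FinUltra.metric FinUltra.ultra FinUltra.fin FinUltra.nonempty

/-- Triples `(P, p₊, p₋)`: an ultrametric space `P` with spectrum contained in `Λ` and isometric
embeddings `p₊ : X → P` (called `left`) and `p₋ : Y → P` (called `right`) whose images
cover `P`. -/
structure Triple {Λ : Set ℝ} (X Y : FinUltra.{u} Λ) : Type (u + 1) where
  P : Type u
  [metric : MetricSpace P]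
  [ultra : IsUltrametricDist P]
  left : X.carrier → P
  right : Y.carrier → P
  isometry_left : Isometry left
  isometry_right : Isometry right
  range_union : Set.range left ∪ Set.range right = Set.univ
  spectrum_subset : distSpectrum P ⊆ Λ

attribute [instance] Triple.metric Triple.ultra

namespace Triple

variable {Λ : Set ℝ} {X Y Z W : FinUltra.{u} Λ}

/-- Two triples are identified if there is an isometry `π : P → P'` with `p'± = π ∘ p±`. -/
def Equivalent (p p' : Triple X Y) : Prop :=
  ∃ π : p.P ≃ᵢ p'.P, (∀ x, π (p.left x) = p'.left x) ∧ ∀ y, π (p.right y) = p'.right y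

instance setoid (X Y : FinUltra.{u} Λ) : Setoid (Triple X Y) where
  r := Equivalent
  iseqv :=
    { refl := fun p => ⟨IsometryEquiv.refl _, fun _ => rfl, fun _ => rfl⟩
      symm := by
        rintro p q ⟨π, h1, h2⟩
        exact ⟨π.symm, fun x => by rw [← h1, π.symm_apply_apply],
          fun y => by rw [← h2, π.symm_apply_apply]⟩
      trans := by
        rintro p q r ⟨π, h1, h2⟩ ⟨σ, h3, h4⟩
        exact ⟨π.trans σ, fun x => by simp [h1, h3], fun y => by simp [h2, h4]⟩ }

/-- The distance in `P` between a point of `X` and a point of `Y`. -/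
def cross (p : Triple X Y) (x : X.carrier) (y : Y.carrier) : ℝ := dist (p.left x) (p.right y)

theorem exists_preimage (p : Triple X Y) (a : p.P) :
    ∃ s : X.carrier ⊕ Y.carrier, Sum.elim p.left p.right s = a := by
  have h : a ∈ Set.range p.left ∪ Set.range p.right := by rw [p.range_union]; trivial
  rcases h with ⟨x, rfl⟩ | ⟨y, rfl⟩
  · exact ⟨Sum.inl x, rfl⟩
  · exact ⟨Sum.inr y, rfl⟩

theorem equivalent_of_cross {p p' : Triple X Y} (h : ∀ x y, p.cross x y = p'.cross x y) :
    Equivalent p p' := by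
  have hd : ∀ s t : X.carrier ⊕ Y.carrier,
      dist (Sum.elim p.left p.right s) (Sum.elim p.left p.right t) =
      dist (Sum.elim p'.left p'.right s) (Sum.elim p'.left p'.right t) := by
    rintro (x | y) (x' | y')
    · simp [p.isometry_left.dist_eq, p'.isometry_left.dist_eq]
    · exact h x y'
    · simpa [cross, dist_comm] using h x' y
    · simp [p.isometry_right.dist_eq, p'.isometry_right.dist_eq]
  choose s hs using p.exists_preimage
  choose t ht using p'.exists_preimage
  have h1 : ∀ a, Sum.elim p'.left p'.right (s (Sum.elim p.left p.right a)) =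
      Sum.elim p'.left p'.right a := fun a => by
    rw [← dist_eq_zero, ← hd, hs, dist_self]
  have h2 : ∀ a, Sum.elim p.left p.right (t (Sum.elim p'.left p'.right a)) =
      Sum.elim p.left p.right a := fun a => by
    rw [← dist_eq_zero, hd, ht, dist_self]
  refine ⟨IsometryEquiv.mk'
    (fun a => Sum.elim p'.left p'.right (s a)) (fun b => Sum.elim p.left p.right (t b))
    (fun b => by rw [h1, ht]) (Isometry.of_dist_eq fun a b => by rw [← hd, hs, hs]),
    fun x => h1 (Sum.inl x), fun y => h1 (Sum.inr y)⟩

theorem Equivalent.cross_eq {p p' : Triple X Y} (h : Equivalent p p') (x : X.carrier)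
    (y : Y.carrier) : p.cross x y = p'.cross x y := by
  obtain ⟨π, h1, h2⟩ := h
  rw [cross, cross, ← h1, ← h2, π.isometry.dist_eq]

theorem cross_nonneg (p : Triple X Y) (x : X.carrier) (y : Y.carrier) : 0 ≤ p.cross x y :=
  dist_nonneg

/-- The disjoint union `P ⊔ Q` of the spaces of two triples `X → Y` and `Y → Z`. -/
def Disj (p : Triple X Y) (q : Triple Y Z) : Type u := p.P ⊕ q.P

/-- The amalgamated distance between a point of `P` and a point of `Q`:
the minimum over `y ∈ Y` of `max (d_P (a, p₋ y)) (d_Q (q₊ y, b))`. -/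
noncomputable def amalgDist (p : Triple X Y) (q : Triple Y Z) (a : p.P) (b : q.P) : ℝ :=
  ⨅ y : Y.carrier, max (dist a (p.right y)) (dist (q.left y) b)

theorem exists_amalgDist (p : Triple X Y) (q : Triple Y Z) (a : p.P) (b : q.P) :
    ∃ y, max (dist a (p.right y)) (dist (q.left y) b) = p.amalgDist q a b :=
  exists_eq_ciInf_of_finite

theorem amalgDist_le (p : Triple X Y) (q : Triple Y Z) (a : p.P) (b : q.P) (y : Y.carrier) :
    p.amalgDist q a b ≤ max (dist a (p.right y)) (dist (q.left y) b) :=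
  ciInf_le (Set.finite_range _).bddBelow y

theorem amalgDist_nonneg (p : Triple X Y) (q : Triple Y Z) (a : p.P) (b : q.P) :
    0 ≤ p.amalgDist q a b := by
  obtain ⟨y, hy⟩ := p.exists_amalgDist q a b
  rw [← hy]
  exact le_max_of_le_left dist_nonneg

/-- The distance on `P ⊔ Q`. -/
noncomputable def sumDist (p : Triple X Y) (q : Triple Y Z) : p.Disj q → p.Disj q → ℝ
  | .inl a, .inl b => dist a b
  | .inl a, .inr b => p.amalgDist q a b
  | .inr a, .inl b => p.amalgDist q b a
  | .inr a, .inr b => dist a b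

theorem sumDist_comm (p : Triple X Y) (q : Triple Y Z) (a b : p.Disj q) :
    p.sumDist q a b = p.sumDist q b a := by
  rcases a with a | a <;> rcases b with b | b <;> simp [sumDist, dist_comm]

theorem sumDist_nonneg (p : Triple X Y) (q : Triple Y Z) (a b : p.Disj q) :
    0 ≤ p.sumDist q a b := by
  rcases a with a | a <;> rcases b with b | b <;> simp [sumDist, amalgDist_nonneg]

theorem amalgDist_left (p : Triple X Y) (q : Triple Y Z) (a b : p.P) (c : q.P) :
    p.amalgDist q a c ≤ max (dist a b) (p.amalgDist q b c) := by
  obtain ⟨y, hy⟩ := p.exists_amalgDist q b c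
  refine (p.amalgDist_le q a c y).trans ?_
  rw [← hy]
  have := dist_triangle_max a b (p.right y)
  grind

theorem amalgDist_right (p : Triple X Y) (q : Triple Y Z) (a : p.P) (b c : q.P) :
    p.amalgDist q a c ≤ max (p.amalgDist q a b) (dist b c) := by
  obtain ⟨y, hy⟩ := p.exists_amalgDist q a b
  refine (p.amalgDist_le q a c y).trans ?_
  rw [← hy]
  have := dist_triangle_max (q.left y) b c
  grind

theorem dist_le_amalgDist_left (p : Triple X Y) (q : Triple Y Z) (a b : p.P) (c : q.P) :
    dist a b ≤ max (p.amalgDist q a c) (p.amalgDist q b c) := by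
  obtain ⟨y, hy⟩ := p.exists_amalgDist q a c
  obtain ⟨z, hz⟩ := p.exists_amalgDist q b c
  have h1 := dist_triangle_max a (p.right y) b
  have h2 := dist_triangle_max (p.right y) (p.right z) b
  have h3 := dist_triangle_max (q.left y) c (q.left z)
  have h4 : dist (p.right y) (p.right z) = dist (q.left y) (q.left z) := by
    rw [p.isometry_right.dist_eq, q.isometry_left.dist_eq]
  rw [dist_comm b] at hz
  rw [dist_comm c] at h3
  grind

theorem dist_le_amalgDist_right (p : Triple X Y) (q : Triple Y Z) (a : p.P) (b c : q.P) :
    dist b c ≤ max (p.amalgDist q a b) (p.amalgDist q a c) := by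
  obtain ⟨y, hy⟩ := p.exists_amalgDist q a b
  obtain ⟨z, hz⟩ := p.exists_amalgDist q a c
  have h1 := dist_triangle_max b (q.left y) c
  have h2 := dist_triangle_max (q.left y) (q.left z) c
  have h3 := dist_triangle_max (p.right y) a (p.right z)
  have h4 : dist (p.right y) (p.right z) = dist (q.left y) (q.left z) := by
    rw [p.isometry_right.dist_eq, q.isometry_left.dist_eq]
  rw [dist_comm (q.left y)] at hy
  rw [dist_comm (p.right y) a] at h3
  grind

theorem sumDist_triangle_max (p : Triple X Y) (q : Triple Y Z) (a b c : p.Disj q) :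
    p.sumDist q a c ≤ max (p.sumDist q a b) (p.sumDist q b c) := by
  rcases a with a | a <;> rcases b with b | b <;> rcases c with c | c <;> simp only [sumDist]
  · exact dist_triangle_max a b c
  · exact p.amalgDist_left q a b c
  · exact p.dist_le_amalgDist_left q a c b
  · exact p.amalgDist_right q a b c
  · rw [max_comm, dist_comm b]; exact p.amalgDist_left q c b a
  · exact p.dist_le_amalgDist_right q b a c
  · rw [max_comm, dist_comm a]; exact p.amalgDist_right q c b a
  · exact dist_triangle_max a b c

noncomputable instance (p : Triple X Y) (q : Triple Y Z) : PseudoMetricSpace (p.Disj q) where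
  dist := p.sumDist q
  dist_self := by rintro (a | a) <;> simp [sumDist]
  dist_comm := p.sumDist_comm q
  dist_triangle a b c := (p.sumDist_triangle_max q a b c).trans
    (max_le_add_of_nonneg (p.sumDist_nonneg q a b) (p.sumDist_nonneg q b c))

/-- The amalgam `P ⋈ Q` of `P` and `Q` over `Y`: the disjoint union `P ⊔ Q` with `p₋ y` and `q₊ y`
identified for each `y ∈ Y`. These are exactly the pairs of distinct points of `P ⊔ Q` that have
amalgamated distance zero (see `sumDist_eq_zero_iff`). -/
abbrev Amalgam (p : Triple X Y) (q : Triple Y Z) : Type u := SeparationQuotient (p.Disj q)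

theorem sumDist_eq_zero_iff (p : Triple X Y) (q : Triple Y Z) (a : p.P) (b : q.P) :
    p.sumDist q (.inl a) (.inr b) = 0 ↔ ∃ y, a = p.right y ∧ b = q.left y := by
  constructor
  · intro h
    obtain ⟨y, hy⟩ := p.exists_amalgDist q a b
    rw [show p.amalgDist q a b = 0 from h] at hy
    refine ⟨y, dist_le_zero.1 (hy ▸ le_max_left _ _), ?_⟩
    exact (dist_le_zero.1 (hy ▸ le_max_right _ _)).symm
  · rintro ⟨y, rfl, rfl⟩
    refine le_antisymm ((p.amalgDist_le q _ _ y).trans ?_) (p.amalgDist_nonneg q _ _)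
    simp

instance (p : Triple X Y) (q : Triple Y Z) : IsUltrametricDist (p.Amalgam q) where
  dist_triangle_max a b c := by
    obtain ⟨a, rfl⟩ := SeparationQuotient.surjective_mk a
    obtain ⟨b, rfl⟩ := SeparationQuotient.surjective_mk b
    obtain ⟨c, rfl⟩ := SeparationQuotient.surjective_mk c
    simp only [SeparationQuotient.dist_mk]
    exact p.sumDist_triangle_max q _ _ _

theorem amalgam_spectrum (p : Triple X Y) (q : Triple Y Z) :
    distSpectrum (p.Amalgam q) ⊆ Λ := by
  have key : ∀ (a : p.P) (b : q.P), p.amalgDist q a b ≠ 0 → p.amalgDist q a b ∈ Λ := by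
    intro a b h0
    obtain ⟨y, hy⟩ := p.exists_amalgDist q a b
    rw [← hy] at h0 ⊢
    rcases max_choice (dist a (p.right y)) (dist (q.left y) b) with h | h
    · rw [h] at h0 ⊢
      exact p.spectrum_subset ⟨_, _, dist_ne_zero.1 h0, rfl⟩
    · rw [h] at h0 ⊢
      exact q.spectrum_subset ⟨_, _, dist_ne_zero.1 h0, rfl⟩
  rintro r ⟨a, b, hab, rfl⟩
  obtain ⟨a, rfl⟩ := SeparationQuotient.surjective_mk a
  obtain ⟨b, rfl⟩ := SeparationQuotient.surjective_mk b
  rw [← dist_ne_zero] at hab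
  rw [SeparationQuotient.dist_mk] at hab ⊢
  change p.sumDist q a b ≠ 0 at hab
  change p.sumDist q a b ∈ Λ
  rcases a with a | a <;> rcases b with b | b
  · exact p.spectrum_subset ⟨a, b, dist_ne_zero.1 hab, rfl⟩
  · exact key a b hab
  · exact key b a hab
  · exact q.spectrum_subset ⟨a, b, dist_ne_zero.1 hab, rfl⟩

/-- The map `p₊ : X → P ⋈ Q`. -/
noncomputable def amalgLeft (p : Triple X Y) (q : Triple Y Z) (x : X.carrier) : p.Amalgam q :=
  SeparationQuotient.mk (X := p.Disj q) (Sum.inl (p.left x))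

/-- The map `q₋ : Z → P ⋈ Q`. -/
noncomputable def amalgRight (p : Triple X Y) (q : Triple Y Z) (z : Z.carrier) : p.Amalgam q :=
  SeparationQuotient.mk (X := p.Disj q) (Sum.inr (q.right z))

/-- The product `q ⋄ p`: the subspace `p₊(X) ∪ q₋(Z)` of `P ⋈ Q` with the embeddings `p₊`, `q₋`. -/
noncomputable def comp (p : Triple X Y) (q : Triple Y Z) : Triple X Z where
  P := ↥(Set.range (p.amalgLeft q) ∪ Set.range (p.amalgRight q))
  left x := ⟨p.amalgLeft q x, Or.inl ⟨x, rfl⟩⟩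
  right z := ⟨p.amalgRight q z, Or.inr ⟨z, rfl⟩⟩
  isometry_left := Isometry.of_dist_eq fun x x' => p.isometry_left.dist_eq x x'
  isometry_right := Isometry.of_dist_eq fun z z' => q.isometry_right.dist_eq z z'
  range_union := by
    ext ⟨a, ha⟩
    simpa [Subtype.ext_iff] using ha
  spectrum_subset := by
    rintro r ⟨a, b, hab, rfl⟩
    exact p.amalgam_spectrum q ⟨a, b, fun h => hab (Subtype.ext h), rfl⟩

theorem comp_cross (p : Triple X Y) (q : Triple Y Z) (x : X.carrier) (z : Z.carrier) :
    (p.comp q).cross x z = ⨅ y, max (p.cross x y) (q.cross y z) := rfl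

/-- The unit triple: `P = X` and `p±` the identity. -/
def one (X : FinUltra.{u} Λ) : Triple X X where
  P := X.carrier
  left := id
  right := id
  isometry_left := isometry_id
  isometry_right := isometry_id
  range_union := by simp
  spectrum_subset := X.spectrum_subset

/-- The involution: `P` stays the same, `p₊` and `p₋` are interchanged. -/
def star (p : Triple X Y) : Triple Y X where
  P := p.P
  left := p.right
  right := p.left
  isometry_left := p.isometry_right
  isometry_right := p.isometry_left
  range_union := by rw [Set.union_comm, p.range_union]
  spectrum_subset := p.spectrum_subset

theorem comp_congr {p p' : Triple X Y} {q q' : Triple Y Z} (hp : Equivalent p p')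
    (hq : Equivalent q q') : Equivalent (p.comp q) (p'.comp q') :=
  equivalent_of_cross fun x z => by simp only [comp_cross, hp.cross_eq, hq.cross_eq]

theorem star_congr {p p' : Triple X Y} (hp : Equivalent p p') :
    Equivalent p.star p'.star := by
  obtain ⟨π, h1, h2⟩ := hp
  exact ⟨π, h2, h1⟩

theorem one_comp (p : Triple X Y) : Equivalent ((one X).comp p) p := by
  refine equivalent_of_cross fun x y => le_antisymm ?_ ?_
  · rw [comp_cross]
    refine (ciInf_le (Set.finite_range _).bddBelow x).trans ?_
    exact max_le ((dist_self x).le.trans dist_nonneg) le_rfl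
  · rw [comp_cross]
    refine le_ciInf fun x' => ?_
    have h := dist_triangle_max (p.left x) (p.left x') (p.right y)
    rwa [p.isometry_left.dist_eq] at h

theorem comp_one (p : Triple X Y) : Equivalent (p.comp (one Y)) p := by
  refine equivalent_of_cross fun x y => le_antisymm ?_ ?_
  · rw [comp_cross]
    refine (ciInf_le (Set.finite_range _).bddBelow y).trans ?_
    exact max_le le_rfl ((dist_self y).le.trans dist_nonneg)
  · rw [comp_cross]
    refine le_ciInf fun y' => ?_
    have h := dist_triangle_max (p.left x) (p.right y') (p.right y)
    rwa [p.isometry_right.dist_eq] at h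

theorem comp_assoc (p : Triple X Y) (q : Triple Y Z) (r : Triple Z W) :
    Equivalent ((p.comp q).comp r) (p.comp (q.comp r)) := by
  refine equivalent_of_cross fun x w => le_antisymm ?_ ?_
  · rw [comp_cross p]
    refine le_ciInf fun y => ?_
    rw [comp_cross]
    obtain ⟨z, hz⟩ := exists_eq_ciInf_of_finite (f := fun z => max (q.cross y z) (r.cross z w))
    rw [comp_cross q, ← hz]
    refine (ciInf_le (Set.finite_range _).bddBelow z).trans ?_
    rw [comp_cross, ← max_assoc]
    exact max_le_max_right _ (ciInf_le (Set.finite_range _).bddBelow y)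
  · rw [comp_cross (p.comp q)]
    refine le_ciInf fun z => ?_
    rw [comp_cross]
    obtain ⟨y, hy⟩ := exists_eq_ciInf_of_finite (f := fun y => max (p.cross x y) (q.cross y z))
    rw [comp_cross p, ← hy]
    refine (ciInf_le (Set.finite_range _).bddBelow y).trans ?_
    rw [comp_cross, max_assoc]
    exact max_le_max_left _ (ciInf_le (Set.finite_range _).bddBelow z)

end Triple

/-- The amalgamation category: morphisms `X ⟶ Y` are triples `(P, p₊, p₋)` up to isometry.
In Mathlib's order of composition, the product `q ⋄ p` is written `p ≫ q`. -/
noncomputable instance category (Λ : Set ℝ) : Category.{u + 1} (FinUltra.{u} Λ) where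
  Hom X Y := Quotient (Triple.setoid X Y)
  id X := Quotient.mk _ (Triple.one X)
  comp := Quotient.map₂ Triple.comp fun _ _ hp _ _ hq => Triple.comp_congr hp hq
  id_comp := by rintro X Y ⟨p⟩; exact Quotient.sound (Triple.one_comp p)
  comp_id := by rintro X Y ⟨p⟩; exact Quotient.sound (Triple.comp_one p)
  assoc := by rintro X Y Z W ⟨p⟩ ⟨q⟩ ⟨r⟩; exact Quotient.sound (Triple.comp_assoc p q r)

/-- The morphism represented by a triple. -/
def Triple.toHom {Λ : Set ℝ} {X Y : FinUltra.{u} Λ} (p : Triple X Y) : X ⟶ Y :=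
  Quotient.mk (Triple.setoid X Y) p

/-- The involution `p ↦ p*` on morphisms. -/
def involution {Λ : Set ℝ} {X Y : FinUltra.{u} Λ} : (X ⟶ Y) → (Y ⟶ X) :=
  Quotient.map Triple.star fun _ _ h => Triple.star_congr h

/-! ## The isometry group, stabilizers of finite subsets and double cosets -/

/-- The topology of pointwise convergence on the group of all isometries of `U`. -/
instance isometryGroupTopology (U : Type u) [MetricSpace U] : TopologicalSpace (U ≃ᵢ U) :=
  TopologicalSpace.induced (fun g => (g : U → U)) inferInstance

/-- The quotient topology on a double coset space. -/
instance doubleCosetTopology {G : Type u} [Group G] [TopologicalSpace G] (K L : Set G) :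
    TopologicalSpace (DoubleCoset.Quotient K L) :=
  TopologicalSpace.coinduced (Quotient.mk (DoubleCoset.setoid K L)) inferInstance

/-- Non-empty finite subsets of `U`. -/
abbrev FinSub (U : Type u) : Type u := {X : Finset U // X.Nonempty}

/-- The pointwise stabilizer of a finite subset. -/
def pointStabilizer {U : Type u} [MetricSpace U] (X : FinSub U) : Subgroup (U ≃ᵢ U) where
  carrier := {g | ∀ x ∈ X.1, g x = x}
  one_mem' _ _ := rfl
  mul_mem' {g h} hg hh x hx := by
    change g (h x) = x
    rw [hh x hx, hg x hx]
  inv_mem' {g} hg x hx := by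
    change g.symm x = x
    rw [IsometryEquiv.symm_apply_eq, hg x hx]

/-- The double coset space `𝕀[Y] \ 𝕀 / 𝕀[X]`. -/
abbrev Cosets {U : Type u} [MetricSpace U] (X Y : FinSub U) : Type u :=
  DoubleCoset.Quotient (pointStabilizer Y : Set (U ≃ᵢ U)) (pointStabilizer X : Set (U ≃ᵢ U))

theorem IsUrysohn.subset_spectrum {Λ : Set ℝ} {U : Type u} [MetricSpace U] (hU : IsUrysohn Λ U)
    (S : Set U) : distSpectrum S ⊆ Λ := by
  rintro r ⟨a, b, hab, rfl⟩
  rw [← hU.spectrum_eq]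
  exact ⟨a, b, fun h => hab (Subtype.ext h), rfl⟩

/-- A non-empty finite subset of the Urysohn space as an object of the amalgamation category. -/
def IsUrysohn.obj {Λ : Set ℝ} {U : Type u} [MetricSpace U] (hU : IsUrysohn Λ U)
    (X : FinSub U) : FinUltra.{u} Λ :=
  haveI := hU.ultrametric
  haveI : Nonempty X.1 := X.2.to_subtype
  { carrier := X.1
    spectrum_subset := hU.subset_spectrum (X.1 : Set U) }

/-- The morphism `X ⟶ Y` determined by an isometry `g`: the subspace `P = Y ∪ g(X)` of `U`
with `p₊ = g` on `X` and `p₋` the identical embedding of `Y`. -/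
def IsUrysohn.mor {Λ : Set ℝ} {U : Type u} [MetricSpace U] (hU : IsUrysohn Λ U)
    (X Y : FinSub U) (g : U ≃ᵢ U) : hU.obj X ⟶ hU.obj Y :=
  haveI := hU.ultrametric
  Triple.toHom (X := hU.obj X) (Y := hU.obj Y)
    { P := ↥((Y.1 : Set U) ∪ g '' (X.1 : Set U))
      left := fun x : X.1 => ⟨g x, Or.inr ⟨x, x.2, rfl⟩⟩
      right := fun y : Y.1 => ⟨y, Or.inl y.2⟩
      isometry_left := Isometry.of_dist_eq fun x x' => g.isometry.dist_eq (x : X.1).1 (x' : X.1).1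
      isometry_right := Isometry.of_dist_eq fun _ _ => rfl
      range_union := by
        rw [Set.eq_univ_iff_forall]
        rintro ⟨a, ha | ⟨x, hx, rfl⟩⟩
        · exact Or.inr ⟨(⟨a, ha⟩ : Y.1), rfl⟩
        · exact Or.inl ⟨(⟨x, hx⟩ : X.1), rfl⟩
      spectrum_subset := hU.subset_spectrum _ }

/-! ## Unitary representations and compressed operators -/

/-- A unitary representation of the isometry group of `U` in a Hilbert space `H`: a homomorphism
to the unitary group of `H`, continuous for the strong operator topology. -/
structure UnitaryRep (U : Type u) [MetricSpace U] (H : Type v) [NormedAddCommGroup H]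
    [InnerProductSpace ℂ H] [CompleteSpace H] where
  toHom : (U ≃ᵢ U) →* unitary (H →L[ℂ] H)
  strongly_continuous : ∀ ξ : H, Continuous fun g => (toHom g : H →L[ℂ] H) ξ

section Rep

variable {U : Type u} [MetricSpace U] {H : Type v} [NormedAddCommGroup H]
  [InnerProductSpace ℂ H] [CompleteSpace H]

/-- The operator `ρ(g)`. -/
noncomputable def UnitaryRep.op (ρ : UnitaryRep U H) (g : U ≃ᵢ U) : H →L[ℂ] H := (ρ.toHom g : H →L[ℂ] H)

/-- The subspace `H[X]` of vectors fixed by the pointwise stabilizer of `X`. -/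
def UnitaryRep.fixed (ρ : UnitaryRep U H) (X : FinSub U) : Submodule ℂ H where
  carrier := {ξ | ∀ g ∈ pointStabilizer X, ρ.op g ξ = ξ}
  zero_mem' _ _ := map_zero _
  add_mem' {ξ η} hξ hη g hg := by rw [map_add, hξ g hg, hη g hg]
  smul_mem' c ξ hξ g hg := by rw [map_smul, hξ g hg]

theorem UnitaryRep.isClosed_fixed (ρ : UnitaryRep U H) (X : FinSub U) :
    IsClosed (ρ.fixed X : Set H) := by
  have : (ρ.fixed X : Set H) = ⋂ g ∈ pointStabilizer X, {ξ | ρ.op g ξ = ξ} := by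
    ext ξ
    simp [UnitaryRep.fixed]
  rw [this]
  exact isClosed_biInter fun g _ => isClosed_eq (ρ.op g).continuous continuous_id

instance (ρ : UnitaryRep U H) (X : FinSub U) : CompleteSpace (ρ.fixed X) :=
  (ρ.isClosed_fixed X).completeSpace_coe

/-- The compressed operator `Π[Y] ρ(g) : H[X] → H[Y]`, where `Π[Y]` is the orthogonal projection
to `H[Y]`. -/
noncomputable def UnitaryRep.compress (ρ : UnitaryRep U H) (X Y : FinSub U) (g : U ≃ᵢ U) :
    ρ.fixed X →L[ℂ] ρ.fixed Y :=
  (ρ.fixed Y).orthogonalProjectionOnto ∘L ρ.op g ∘L (ρ.fixed X).subtypeL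

end Rep

end UltraUrysohn

/-! A back-and-forth argument shows that $\mathbb U$ is homogeneous: every finite partial isometry
extends to an element of $\mathbb I$ (`exists_isometryEquiv`). A morphism is determined by its cross
distances $d(p_+(x),p_-(y))$. Homogeneity applied to $g(X)\cup Y$ therefore shows that isometries
with equal cross distances lie in one double coset (`mor_eq_mor_iff`), and the extension property
realizes every triple (`mor_surjective`).

On the operator side everything except multiplicativity is formal, because matrix coefficients of
$\widehat\rho(g)$ between fixed vectors are those of $\rho(g)$ (`inner_compress`).

For multiplicativity, let $v=\rho(g)\xi$ and $w=\Pi[Y]v$. The point of least norm in the closed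
convex hull of the orbit $\rho(\mathbb I[Y])v$ is $w$ (`starProjection_fixed_mem`), so $w$ is
approximated by finite convex combinations $\sum t_i\rho(l_i)v$ with $l_i\in\mathbb I[Y]$. A single
$k\in\mathbb I[Y]$ moves all the sets $l_ig(X)$ into free position relative to $h^{-1}(Z)$ over $Y$,
so that every $hkl_ig$ represents $\mathfrak q\diamond\mathfrak p$ (`exists_mor_eq_comp`). Applying
$\rho(hk)$ to the combination then gives exactly the coefficient of $\widehat\rho(\mathfrak
q\diamond\mathfrak p)$, while $\rho(hk)w=\rho(h)w$. The error is at most $\|\zeta\|$ times the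
approximation error. -/

namespace UltraUrysohn

/-! ## Homogeneity of the Urysohn space -/

/-! ### Densely defined partial isometries of complete spaces. -/

section Extension

variable {A B : Type*} [MetricSpace A] [MetricSpace B]

/-- The pairs in the relation `R` form a partial isometry. -/
def IsPartialIsometry (R : Set (A × B)) : Prop :=
  ∀ p ∈ R, ∀ q ∈ R, dist p.1 q.1 = dist p.2 q.2

/-- Equality of the two distances is a closed condition on pairs of points of `A × B`, and the
closure of `R ×ˢ R` is the product of the closures. -/
theorem IsPartialIsometry.closure {R : Set (A × B)} (hR : IsPartialIsometry R) :
    IsPartialIsometry (closure R) := by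
  have hcl : IsClosed {z : (A × B) × (A × B) | dist z.1.1 z.2.1 = dist z.1.2 z.2.2} :=
    isClosed_eq (by fun_prop) (by fun_prop)
  intro p hp q hq
  have hmem : (p, q) ∈ _root_.closure (R ×ˢ R) := by
    rw [closure_prod_eq]
    exact ⟨hp, hq⟩
  exact hcl.closure_subset_iff.2 (fun z hz => hR z.1 hz.1 z.2 hz.2) hmem

theorem IsPartialIsometry.swap {R : Set (A × B)} (hR : IsPartialIsometry R) :
    IsPartialIsometry (Prod.swap '' R) := by
  rintro _ ⟨p, hp, rfl⟩ _ ⟨q, hq, rfl⟩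
  exact (hR p hp q hq).symm

theorem Isometry.surjective_of_denseRange {C : Type*} [MetricSpace C] [CompleteSpace C]
    {f : C → A} (hf : Isometry f) (hd : DenseRange f) : Function.Surjective f := by
  rw [← Set.range_eq_univ, ← hf.isClosedEmbedding.isClosed_range.closure_eq]
  exact hd.closure_eq

/-- A partial isometry between complete spaces with dense domain and dense range extends to an
isometry. -/
theorem IsPartialIsometry.exists_isometryEquiv [CompleteSpace A] [CompleteSpace B]
    {R : Set (A × B)} (hR : IsPartialIsometry R) (h₁ : Dense (Prod.fst '' R))
    (h₂ : Dense (Prod.snd '' R)) : ∃ F : A ≃ᵢ B, ∀ p ∈ R, F p.1 = p.2 := by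
  have hc := hR.closure
  have : CompleteSpace (_root_.closure R) := isClosed_closure.completeSpace_coe
  -- The metric of `A × B` is the maximum of the coordinate distances. On the closure of `R` these
  -- agree, so both projections are isometric, and completeness with density makes them onto.
  have i₁ : Isometry fun p : _root_.closure R => p.1.1 := Isometry.of_dist_eq fun p q => by
    rw [Subtype.dist_eq, Prod.dist_eq, ← hc p p.2 q q.2, max_self]
  have i₂ : Isometry fun p : _root_.closure R => p.1.2 := Isometry.of_dist_eq fun p q => by
    rw [Subtype.dist_eq, Prod.dist_eq, hc p p.2 q q.2, max_self]
  have s₁ := Isometry.surjective_of_denseRange i₁ <| h₁.mono <| by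
    rintro _ ⟨p, hp, rfl⟩
    exact ⟨⟨p, subset_closure hp⟩, rfl⟩
  have s₂ := Isometry.surjective_of_denseRange i₂ <| h₂.mono <| by
    rintro _ ⟨p, hp, rfl⟩
    exact ⟨⟨p, subset_closure hp⟩, rfl⟩
  let e₁ : _root_.closure R ≃ᵢ A := ⟨Equiv.ofBijective _ ⟨i₁.injective, s₁⟩, i₁⟩
  let e₂ : _root_.closure R ≃ᵢ B := ⟨Equiv.ofBijective _ ⟨i₂.injective, s₂⟩, i₂⟩
  refine ⟨e₁.symm.trans e₂, fun p hp => ?_⟩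
  have : e₁.symm p.1 = ⟨p, subset_closure hp⟩ := by
    rw [IsometryEquiv.symm_apply_eq]
    rfl
  rw [IsometryEquiv.trans_apply, this]
  rfl

end Extension

/-- The images of `X` and `Y` cover `P` and carry prescribed metrics, so only the cross distances
are free. Identities between morphisms thus become identities between real numbers. -/
theorem Triple.toHom_eq_iff {Λ : Set ℝ} {X Y : FinUltra.{u} Λ} (p q : Triple X Y) :
    p.toHom = q.toHom ↔ ∀ x y, p.cross x y = q.cross x y :=
  ⟨fun h => (Quotient.exact h).cross_eq, fun h => Quotient.sound (Triple.equivalent_of_cross h)⟩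

/-! ### Homogeneity by back-and-forth, and its consequences for double cosets. -/

namespace IsUrysohn

variable {Λ : Set ℝ} {U : Type u} [MetricSpace U]

/-- A finite partial isometry of the Urysohn space extends to any additional point. -/
theorem exists_extend_point (hU : IsUrysohn Λ U) {R : Set (U × U)} (hf : R.Finite)
    (hR : IsPartialIsometry R) (a : U) : ∃ b, IsPartialIsometry (insert (a, b) R) := by
  have := hU.ultrametric
  let S : Set U := insert a (Prod.fst '' R)
  have : Finite S := ((hf.image _).insert a).to_subtype
  let X : Set S := {s | (s : U) ∈ Prod.fst '' R}
  choose f hf₁ hf₂ using fun x : X => x.2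
  obtain ⟨g, hg, hgf⟩ := hU.extension S (hU.subset_spectrum S) X (fun x => (f x).2)
    (Isometry.of_dist_eq fun x y => by
      rw [← hR _ (hf₁ x) _ (hf₁ y), hf₂, hf₂]
      rfl)
  -- A partial isometry is single-valued, so the chosen partner of `p.1` is `p.2`.
  have hgR : ∀ p (hp : p ∈ R), g ⟨p.1, Or.inr ⟨p, hp, rfl⟩⟩ = p.2 := fun p hp => by
    have hx : (⟨p.1, Or.inr ⟨p, hp, rfl⟩⟩ : S) ∈ X := ⟨p, hp, rfl⟩
    rw [hgf ⟨_, hx⟩, ← dist_eq_zero, ← hR _ (hf₁ _) _ hp, hf₂, dist_self]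
  have hga : ∀ p ∈ R, dist a p.1 = dist (g ⟨a, Or.inl rfl⟩) p.2 := fun p hp => by
    rw [← hgR p hp, hg.dist_eq]
    rfl
  refine ⟨g ⟨a, Or.inl rfl⟩, ?_⟩
  rintro p (rfl | hp) q (rfl | hq)
  · simp
  · exact hga q hq
  · rw [dist_comm, hga p hp, dist_comm]
  · exact hR p hp q hq

/-- The Urysohn space is homogeneous: a finite partial isometry extends to an isometry of the
whole space. -/
theorem exists_isometryEquiv (hU : IsUrysohn Λ U) {R : Set (U × U)} (hf : R.Finite)
    (hR : IsPartialIsometry R) : ∃ F : U ≃ᵢ U, ∀ p ∈ R, F p.1 = p.2 := by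
  have := hU.complete
  have := hU.separable
  obtain ⟨D, hDc, hD⟩ := TopologicalSpace.exists_countable_dense U
  have := hDc.to_subtype
  let _ := Encodable.ofCountable (D ⊕ D)
  let Q := {S : Set (U × U) // S.Finite ∧ IsPartialIsometry S}
  -- One cofinal family for each task: the left copy of `D` puts a point into the domain, the right
  -- copy puts it into the range by extending the inverse relation. An ideal meeting all of them has
  -- dense domain and dense range.
  let 𝒟 : D ⊕ D → Order.Cofinal Q := Sum.elim
    (fun a => ⟨{S | (a : U) ∈ Prod.fst '' S.1}, fun S => by
      obtain ⟨b, hb⟩ := hU.exists_extend_point S.2.1 S.2.2 a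
      exact ⟨⟨_, S.2.1.insert _, hb⟩, ⟨_, Set.mem_insert _ _, rfl⟩, Set.subset_insert _ _⟩⟩)
    (fun a => ⟨{S | (a : U) ∈ Prod.snd '' S.1}, fun S => by
      obtain ⟨b, hb⟩ := hU.exists_extend_point (S.2.1.image Prod.swap) S.2.2.swap a
      refine ⟨⟨insert (b, (a : U)) S.1, S.2.1.insert _, ?_⟩, ⟨_, Set.mem_insert _ _, rfl⟩,
        Set.subset_insert _ _⟩
      convert hb.swap
      rw [Set.image_insert_eq, Set.image_image]
      simp⟩)
  let I := Order.idealOfCofinals (⟨R, hf, hR⟩ : Q) 𝒟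
  have hT : IsPartialIsometry {p | ∃ S ∈ I, p ∈ S.1} := by
    rintro p ⟨S, hS, hp⟩ q ⟨T, hT, hq⟩
    obtain ⟨W, -, hSW, hTW⟩ := I.directed S hS T hT
    exact W.2.2 p (hSW hp) q (hTW hq)
  obtain ⟨F, hF⟩ := hT.exists_isometryEquiv
    (hD.mono fun a ha => by
      obtain ⟨S, ⟨p, hp, hpa⟩, hS⟩ := Order.cofinal_meets_idealOfCofinals
        (⟨R, hf, hR⟩ : Q) 𝒟 (Sum.inl ⟨a, ha⟩)
      exact ⟨p, ⟨S, hS, hp⟩, hpa⟩)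
    (hD.mono fun a ha => by
      obtain ⟨S, ⟨p, hp, hpa⟩, hS⟩ := Order.cofinal_meets_idealOfCofinals
        (⟨R, hf, hR⟩ : Q) 𝒟 (Sum.inr ⟨a, ha⟩)
      exact ⟨p, ⟨S, hS, hp⟩, hpa⟩)
  exact ⟨F, fun p hp => hF p ⟨_, Order.mem_idealOfCofinals _ _, hp⟩⟩

/-- Two isometric finite families of points are related by an isometry of the whole space. -/
theorem exists_map_eq (hU : IsUrysohn Λ U) {ι : Type*} [Finite ι] (a b : ι → U)
    (h : ∀ i j, dist (a i) (a j) = dist (b i) (b j)) : ∃ F : U ≃ᵢ U, ∀ i, F (a i) = b i := by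
  obtain ⟨F, hF⟩ := hU.exists_isometryEquiv (Set.finite_range fun i => (a i, b i)) (by
    rintro _ ⟨i, rfl⟩ _ ⟨j, rfl⟩
    exact h i j)
  exact ⟨F, fun i => hF _ ⟨i, rfl⟩⟩

/-! ## Double cosets and morphisms -/

theorem mor_eq_iff (hU : IsUrysohn Λ U) {X Y : FinSub U} (g h : U ≃ᵢ U) :
    hU.mor X Y g = hU.mor X Y h ↔ ∀ x ∈ X.1, ∀ y ∈ Y.1, dist (g x) y = dist (h x) y :=
  (Triple.toHom_eq_iff _ _).trans
    ⟨fun H x hx y hy => H ⟨x, hx⟩ ⟨y, hy⟩, fun H x y => H x.1 x.2 y.1 y.2⟩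

theorem mor_eq_comp_iff (hU : IsUrysohn Λ U) {X Y Z : FinSub U} (g h k : U ≃ᵢ U) :
    hU.mor X Z k = hU.mor X Y g ≫ hU.mor Y Z h ↔ ∀ x ∈ X.1, ∀ z ∈ Z.1,
      dist (k x) z = ⨅ y : Y.1, max (dist (g x) y) (dist (h y) z) :=
  (Triple.toHom_eq_iff _ _).trans
    ⟨fun H x hx z hz => H ⟨x, hx⟩ ⟨z, hz⟩, fun H x z => H x.1 x.2 z.1 z.2⟩

theorem mor_one (hU : IsUrysohn Λ U) (X : FinSub U) : hU.mor X X 1 = 𝟙 (hU.obj X) :=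
  (Triple.toHom_eq_iff _ _).2 fun _ _ => rfl

theorem involution_mor (hU : IsUrysohn Λ U) (X Y : FinSub U) (g : U ≃ᵢ U) :
    involution (hU.mor X Y g) = hU.mor Y X g⁻¹ :=
  (Triple.toHom_eq_iff _ _).2 fun y x => by
    change dist y.1 (g x.1) = dist (g.symm y.1) x.1
    rw [← g.isometry.dist_eq (g.symm y.1), g.apply_symm_apply]

/-- The extension property embeds `P` into `U` so that `Y` goes to itself identically. Homogeneity
then carries `X` onto its copy in the image of `P`. -/
theorem mor_surjective (hU : IsUrysohn Λ U) (X Y : FinSub U) :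
    Function.Surjective (hU.mor X Y) := by
  have := hU.ultrametric
  rintro ⟨p⟩
  have : Finite p.P := by
    have := (Set.finite_range p.left).union (Set.finite_range p.right)
    rw [p.range_union] at this
    exact Set.finite_univ_iff.1 this
  choose s hs using fun a : Set.range p.right => a.2
  obtain ⟨f, hf, hfs⟩ := hU.extension p.P p.spectrum_subset (Set.range p.right)
    (fun a => (s a : Y.1).1) (Isometry.of_dist_eq fun a b => by
      change dist (s a) (s b) = _
      rw [← p.isometry_right.dist_eq, hs, hs]
      rfl)
  have hfr : ∀ y : Y.1, f (p.right y) = y := fun y => by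
    rw [hfs ⟨_, y, rfl⟩]
    exact congrArg Subtype.val (p.isometry_right.injective (hs ⟨_, y, rfl⟩))
  obtain ⟨g, hg⟩ := hU.exists_map_eq (fun x : X.1 => (x : U)) (fun x : X.1 => f (p.left x))
    fun x x' => by
      rw [hf.dist_eq]
      exact (p.isometry_left.dist_eq x x').symm
  refine ⟨g, (Triple.toHom_eq_iff _ p).2 fun x y => ?_⟩
  have h : dist (g (x : X.1).1) (y : Y.1).1 = dist (f (p.left x)) (f (p.right y)) :=
    congrArg₂ dist (hg x) (hfr y).symm
  exact h.trans (hf.dist_eq _ _)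

/-- Equal cross distances make the map that sends `g x` to `h x` and fixes `Y` isometric. It extends
to some `a` by homogeneity, and `(a * g)⁻¹ * h` then fixes `X`. -/
theorem mor_eq_mor_iff (hU : IsUrysohn Λ U) {X Y : FinSub U} (g h : U ≃ᵢ U) :
    hU.mor X Y g = hU.mor X Y h ↔
      ∃ a ∈ pointStabilizer Y, ∃ b ∈ pointStabilizer X, h = a * g * b := by
  rw [mor_eq_iff]
  constructor
  · intro H
    obtain ⟨a, ha⟩ := hU.exists_map_eq
      (Sum.elim (fun x : X.1 => g x) fun y : Y.1 => (y : U))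
      (Sum.elim (fun x : X.1 => h x) fun y : Y.1 => (y : U)) <| by
        rintro (x | y) (x' | y')
        · simp [g.isometry.dist_eq, h.isometry.dist_eq]
        · exact H x x.2 y' y'.2
        · simpa [dist_comm] using H x' x'.2 y y.2
        · rfl
    refine ⟨a, fun y hy => ha (Sum.inr ⟨y, hy⟩), (a * g)⁻¹ * h, fun x hx => ?_, by group⟩
    change (a * g).symm (h x) = x
    rw [IsometryEquiv.symm_apply_eq]
    exact (ha (Sum.inl ⟨x, hx⟩)).symm
  · rintro ⟨a, ha, b, hb, rfl⟩ x hx y hy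
    change _ = dist (a (g (b x))) y
    rw [hb x hx, ← a.isometry.dist_eq (g x) y, ha y hy]

/-- Double cosets of point stabilizers correspond to morphisms of the amalgamation category. -/
noncomputable def cosetEquiv (hU : IsUrysohn Λ U) (X Y : FinSub U) :
    Cosets X Y ≃ (hU.obj X ⟶ hU.obj Y) :=
  Equiv.ofBijective
    (Quotient.lift (hU.mor X Y) fun g h hgh =>
      (hU.mor_eq_mor_iff g h).2 (DoubleCoset.rel_iff.1 hgh))
    ⟨by
      rintro ⟨g⟩ ⟨h⟩ hgh
      exact Quotient.sound (DoubleCoset.rel_iff.2 ((hU.mor_eq_mor_iff g h).1 hgh)),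
    fun p => by
      obtain ⟨g, hg⟩ := hU.mor_surjective X Y p
      exact ⟨DoubleCoset.mk _ _ g, hg⟩⟩

theorem cosetEquiv_mk (hU : IsUrysohn Λ U) (X Y : FinSub U) (g : U ≃ᵢ U) :
    hU.cosetEquiv X Y (DoubleCoset.mk _ _ g) = hU.mor X Y g :=
  rfl

/-- Over a finite set `Y`, any two finite sets `B` and `C` can be put in free position by an
isometry fixing `Y`. -/
theorem exists_free_amalgam (hU : IsUrysohn Λ U) (Y : FinSub U) (B C : Finset U) :
    ∃ k ∈ pointStabilizer Y, ∀ b ∈ B, ∀ c ∈ C,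
      dist (k b) c = ⨅ y : Y.1, max (dist b y) (dist (y : U) c) := by
  classical
  -- Adjoining `Y` to both sets makes the distance formula apply to pairs of points of `Y` too. This
  -- forces `dist (k y) y = 0`, so `k` stabilizes `Y`.
  let B' : FinSub U := ⟨Y.1 ∪ B, Y.2.inl⟩
  let C' : FinSub U := ⟨Y.1 ∪ C, Y.2.inl⟩
  obtain ⟨k, hk⟩ := hU.mor_surjective B' C' (hU.mor B' Y 1 ≫ hU.mor Y C' 1)
  have H := (hU.mor_eq_comp_iff 1 1 k).1 hk
  refine ⟨k, fun y hy => ?_, fun b hb c hc =>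
    H b (Finset.mem_union_right _ hb) c (Finset.mem_union_right _ hc)⟩
  rw [← dist_le_zero, H y (Finset.mem_union_left _ hy) y (Finset.mem_union_left _ hy)]
  refine (ciInf_le (Set.finite_range _).bddBelow ⟨y, hy⟩).trans ?_
  simp

end IsUrysohn

/-! ## Compressed operators -/

/-- A point of minimal norm of a convex set is unique. -/
theorem eq_of_norm_le_of_convex {H : Type*} [NormedAddCommGroup H] [InnerProductSpace ℝ H]
    {K : Set H} (hK : Convex ℝ K) {w w' : H} (hw : w ∈ K) (hw' : w' ∈ K)
    (hmin : ∀ x ∈ K, ‖w‖ ≤ ‖x‖) (hn : ‖w'‖ = ‖w‖) : w' = w := by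
  -- The midpoint is no shorter than `w`, so the parallelogram law leaves no room for a nonzero `w'
  -- - w`.
  have hm : (1 / 2 : ℝ) • w' + (1 / 2 : ℝ) • w ∈ K :=
    hK hw' hw (by norm_num) (by norm_num) (by norm_num)
  have h₁ := hmin _ hm
  rw [← smul_add, norm_smul, Real.norm_of_nonneg (by norm_num)] at h₁
  have h₂ := parallelogram_law_with_norm ℝ w' w
  rw [hn] at h₂
  rw [← sub_eq_zero, ← norm_eq_zero]
  nlinarith [norm_nonneg (w' - w), norm_nonneg w]

/-! ### Matrix coefficients, and the projection to fixed vectors as a limit of averages. -/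

namespace UnitaryRep

variable {U : Type u} [MetricSpace U] {H : Type v} [NormedAddCommGroup H]
  [InnerProductSpace ℂ H] [CompleteSpace H] (ρ : UnitaryRep U H)

theorem op_mul (g h : U ≃ᵢ U) (ξ : H) : ρ.op (g * h) ξ = ρ.op g (ρ.op h ξ) := by
  simp [op]

theorem op_one (ξ : H) : ρ.op 1 ξ = ξ := by
  simp [op]

theorem norm_op (g : U ≃ᵢ U) (ξ : H) : ‖ρ.op g ξ‖ = ‖ξ‖ :=
  Unitary.norm_map (ρ.toHom g) ξ

theorem inner_op_op (g : U ≃ᵢ U) (ξ η : H) : inner ℂ (ρ.op g ξ) (ρ.op g η) = inner ℂ ξ η :=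
  Unitary.inner_map_map (ρ.toHom g) ξ η

theorem inner_op_left (g : U ≃ᵢ U) (ξ η : H) :
    inner ℂ (ρ.op g ξ) η = inner ℂ ξ (ρ.op g⁻¹ η) := by
  rw [← ρ.inner_op_op g ξ, ← op_mul, mul_inv_cancel, op_one]

/-- The orthogonal projection is invisible when paired with a vector of `H[Y]`. This removes it from
the arguments about adjoints, units, continuity and products. -/
theorem inner_compress {X Y : FinSub U} (g : U ≃ᵢ U) (ξ : ρ.fixed X) (η : ρ.fixed Y) :
    inner ℂ η (ρ.compress X Y g ξ) = inner ℂ (η : H) (ρ.op g ξ) :=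
  Submodule.inner_orthogonalProjectionOnto_eq_of_mem_left η _

theorem compress_mul_mul {X Y : FinSub U} (g : U ≃ᵢ U) {a b : U ≃ᵢ U}
    (ha : a ∈ pointStabilizer Y) (hb : b ∈ pointStabilizer X) :
    ρ.compress X Y (a * g * b) = ρ.compress X Y g := by
  ext1 ξ
  refine ext_inner_left ℂ fun η => ?_
  rw [inner_compress, inner_compress, op_mul, ξ.2 b hb, op_mul, ← ρ.inner_op_op a η (ρ.op g ξ),
    η.2 a ha]

theorem norm_compress_le (X Y : FinSub U) (g : U ≃ᵢ U) : ‖ρ.compress X Y g‖ ≤ 1 := by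
  refine ContinuousLinearMap.opNorm_le_bound _ zero_le_one fun ξ => ?_
  rw [one_mul]
  refine ((ρ.fixed Y).norm_orthogonalProjectionOnto_apply_le _).trans_eq ?_
  exact ρ.norm_op g ξ

theorem adjoint_compress (X Y : FinSub U) (g : U ≃ᵢ U) :
    ContinuousLinearMap.adjoint (ρ.compress X Y g) = ρ.compress Y X g⁻¹ := by
  refine ((ContinuousLinearMap.eq_adjoint_iff _ _).2 fun η ξ => ?_).symm
  rw [inner_compress, ← inner_conj_symm, inner_compress, inner_conj_symm, inner_op_left, inv_inv]

theorem compress_one (X : FinSub U) :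
    ρ.compress X X 1 = ContinuousLinearMap.id ℂ (ρ.fixed X) := by
  ext1 ξ
  refine ext_inner_left ℂ fun η => ?_
  rw [inner_compress, op_one]
  rfl

theorem continuous_inner_compress {X Y : FinSub U} (ξ : ρ.fixed X) (η : ρ.fixed Y) :
    Continuous fun g => inner ℂ η (ρ.compress X Y g ξ) := by
  simp only [inner_compress]
  exact continuous_const.inner (ρ.strongly_continuous ξ)

/-- The projection of a vector to the fixed vectors of a point stabilizer lies in the closed convex
hull of its orbit. -/
theorem starProjection_fixed_mem (Y : FinSub U) (v : H) :
    (ρ.fixed Y).starProjection v ∈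
      closure (convexHull ℝ ((fun k => ρ.op k v) '' (pointStabilizer Y : Set (U ≃ᵢ U)))) := by
  let _ := InnerProductSpace.rclikeToReal ℂ H
  set S := (fun k => ρ.op k v) '' (pointStabilizer Y : Set (U ≃ᵢ U))
  have hvS : v ∈ S := ⟨1, one_mem _, ρ.op_one v⟩
  have hconv : Convex ℝ (closure (convexHull ℝ S)) := (convex_convexHull ℝ S).closure
  obtain ⟨w, hw, hwmin⟩ := exists_norm_eq_iInf_of_complete_convex
    (K := closure (convexHull ℝ S)) ⟨v, subset_closure (subset_convexHull ℝ S hvS)⟩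
    isClosed_closure.isComplete hconv 0
  have hmin : ∀ x ∈ closure (convexHull ℝ S), ‖w‖ ≤ ‖x‖ := fun x hx => by
    have h := ciInf_le (f := fun y : closure (convexHull ℝ S) => ‖(0 : H) - y‖)
      ⟨0, by rintro _ ⟨y, rfl⟩; exact norm_nonneg _⟩ ⟨x, hx⟩
    rw [← hwmin] at h
    simpa using h
  -- Any closed convex condition satisfied along the orbit passes to the point `w` of least norm. It
  -- yields both invariance of `w` and orthogonality of `v - w`.
  have hind : ∀ C : Set H, IsClosed C → Convex ℝ C →
      (∀ k ∈ pointStabilizer Y, ρ.op k v ∈ C) → w ∈ C := fun C hC hCc hk => by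
    refine hC.closure_subset_iff.2 (convexHull_min ?_ hCc) hw
    rintro _ ⟨k, hkY, rfl⟩
    exact hk k hkY
  -- The stabilizer preserves the hull and the norm, so `ρ.op a w` is again a point of least norm
  -- and equals `w` by uniqueness.
  have hfix : w ∈ ρ.fixed Y := fun a ha => by
    refine eq_of_norm_le_of_convex hconv hw ?_ hmin (ρ.norm_op a w)
    refine hind (ρ.op a ⁻¹' closure (convexHull ℝ S))
      (isClosed_closure.preimage (ρ.op a).continuous)
      (hconv.linear_preimage ((ρ.op a).toLinearMap.restrictScalars ℝ)) fun k hk => ?_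
    refine subset_closure (subset_convexHull ℝ S ⟨a * k, mul_mem ha hk, ρ.op_mul a k v⟩)
  have horth : v - w ∈ (ρ.fixed Y)ᗮ := by
    rw [Submodule.mem_orthogonal]
    intro η hη
    refine hind {x | inner ℂ η (v - x) = 0} (isClosed_eq (by fun_prop) continuous_const) ?_
      fun k hk => ?_
    · intro x hx y hy a b _ _ hab
      have hxy : v - (a • x + b • y) = a • (v - x) + b • (v - y) := by
        rw [smul_sub, smul_sub, sub_add_sub_comm, ← add_smul, hab, one_smul]
      have hr : ∀ (r : ℝ) (z : H), r • z = (r : ℂ) • z := fun _ _ => rfl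
      change inner ℂ η _ = 0
      rw [hxy, inner_add_right, hr, hr, inner_smul_right, inner_smul_right, hx, hy]
      simp
    -- Unitarity and `ρ.op k η = η` show that `η` has the same inner product with every point of the
    -- orbit.
    · change inner ℂ η (v - ρ.op k v) = 0
      rw [inner_sub_right, ← ρ.inner_op_op k η v, hη k hk, sub_self]
  rwa [Submodule.eq_starProjection_of_mem_orthogonal hfix horth]

end UnitaryRep

/-! ### Multiplicativity of the compressed operators. -/

namespace IsUrysohn

variable {Λ : Set ℝ} {U : Type u} [MetricSpace U] {H : Type v} [NormedAddCommGroup H]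
  [InnerProductSpace ℂ H] [CompleteSpace H]

theorem compress_eq_of_mor_eq (hU : IsUrysohn Λ U) (ρ : UnitaryRep U H) {X Y : FinSub U}
    {g h : U ≃ᵢ U} (hgh : hU.mor X Y g = hU.mor X Y h) :
    ρ.compress X Y g = ρ.compress X Y h := by
  obtain ⟨a, ha, b, hb, rfl⟩ := (hU.mor_eq_mor_iff g h).1 hgh
  exact (ρ.compress_mul_mul g ha hb).symm

/-- Finitely many translates of `X` by the stabilizer of `Y` can be moved simultaneously by the
stabilizer of `Y` into free position over `Y` with respect to `h⁻¹ Z`. -/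
theorem exists_mor_eq_comp (hU : IsUrysohn Λ U) {ι : Type*} [Finite ι] (X Y Z : FinSub U)
    (g h : U ≃ᵢ U) (l : ι → U ≃ᵢ U) (hl : ∀ i, l i ∈ pointStabilizer Y) :
    ∃ k ∈ pointStabilizer Y, ∀ i,
      hU.mor X Z (h * k * l i * g) = hU.mor X Y g ≫ hU.mor Y Z h := by
  classical
  have := Fintype.ofFinite ι
  obtain ⟨k, hk, H⟩ := hU.exists_free_amalgam Y
    (Finset.univ.biUnion fun i => X.1.image fun x => l i (g x)) (Z.1.image h.symm)
  refine ⟨k, hk, fun i => (hU.mor_eq_comp_iff _ _ _).2 fun x hx z hz => ?_⟩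
  have h₁ : dist (h (k (l i (g x)))) z = dist (k (l i (g x))) (h.symm z) := by
    rw [← h.isometry.dist_eq _ (h.symm z), h.apply_symm_apply]
  refine h₁.trans ((H _ ?_ _ (Finset.mem_image_of_mem _ hz)).trans (iInf_congr fun y => ?_))
  · simp only [Finset.mem_biUnion, Finset.mem_univ, true_and]
    exact ⟨i, Finset.mem_image_of_mem _ hx⟩
  -- Since `l i` fixes `Y`, all translates have the same distances to `Y`, and so yield the same
  -- product morphism.
  · have h₂ : dist (l i (g x)) y = dist (g x) y := by
      rw [← (l i).isometry.dist_eq (g x), hl i y y.2]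
    rw [h₂, ← h.isometry.dist_eq y (h.symm z), h.apply_symm_apply]

/-- Multiplicativity of the compressed operators. -/
theorem compress_comp_compress (hU : IsUrysohn Λ U) (ρ : UnitaryRep U H) {X Y Z : FinSub U}
    {g h m : U ≃ᵢ U} (hm : hU.mor X Z m = hU.mor X Y g ≫ hU.mor Y Z h) :
    ρ.compress Y Z h ∘L ρ.compress X Y g = ρ.compress X Z m := by
  ext1 ξ
  refine ext_inner_left ℂ fun ζ => ?_
  rw [ContinuousLinearMap.comp_apply, ρ.inner_compress]
  set w : H := (ρ.compress X Y g ξ : H)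
  have hwY : w ∈ ρ.fixed Y := (ρ.compress X Y g ξ).2
  have hw := ρ.starProjection_fixed_mem Y (ρ.op g ξ)
  set c : ℂ := inner ℂ ζ (ρ.compress X Z m ξ)
  -- The estimate is closed in `v`, so it need only be checked on finite convex combinations of the
  -- orbit. At `v = w` its right side vanishes.
  have hD : IsClosed {v : H | ‖inner ℂ (ζ : H) (ρ.op h w) - c‖ ≤ ‖(ζ : H)‖ * ‖w - v‖} :=
    isClosed_le continuous_const (by fun_prop)
  have key : ‖inner ℂ (ζ : H) (ρ.op h w) - c‖ ≤ ‖(ζ : H)‖ * ‖w - w‖ := by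
    refine hD.closure_subset_iff.2 (fun v hv => ?_) hw
    obtain ⟨ι, _, t, z, -, ht, hz, rfl⟩ := mem_convexHull_iff_exists_fintype.1 hv
    choose l hl hlz using hz
    obtain ⟨k, hk, hkm⟩ := hU.exists_mor_eq_comp X Y Z g h l hl
    have hterm : ∀ i, inner ℂ (ζ : H) (ρ.op (h * k) (z i)) = c := fun i => by
      rw [← hlz i, ← ρ.op_mul, ← ρ.op_mul, ← ρ.inner_compress,
        hU.compress_eq_of_mor_eq ρ ((hkm i).trans hm.symm)]
    have hr : ∀ (r : ℝ) (z : H), r • z = (r : ℂ) • z := fun _ _ => rfl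
    have hsum : inner ℂ (ζ : H) (ρ.op (h * k) (∑ i, t i • z i)) = c := by
      simp only [map_sum, inner_sum, hr, map_smul, inner_smul_right, hterm]
      rw [← Finset.sum_mul, ← Complex.ofReal_sum, ht, Complex.ofReal_one, one_mul]
    -- Here `k` depends on `v`, but it fixes `w`, so the left side of the estimate is unaffected.
    have hwk : ρ.op h w = ρ.op (h * k) w := by rw [ρ.op_mul, hwY k hk]
    change ‖inner ℂ (ζ : H) (ρ.op h w) - c‖ ≤ _
    rw [hwk, ← hsum, ← inner_sub_right, ← map_sub, ← ρ.norm_op (h * k) (w - _)]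
    exact norm_inner_le_norm _ _
  rw [sub_self, norm_zero, mul_zero] at key
  exact sub_eq_zero.1 (norm_le_zero_iff.1 key)

end IsUrysohn
end UltraUrysohn

theorem theorem1p2 (Λ : Set ℝ) (hΛ : Λ ⊆ Set.Ioi 0) (hΛc : Λ.Countable)
    (U : Type u) [MetricSpace U] (hU : UltraUrysohn.IsUrysohn Λ U)
    (H : Type v) [NormedAddCommGroup H] [InnerProductSpace ℂ H] [CompleteSpace H]
    (ρ : UltraUrysohn.UnitaryRep U H) :
    -- the compressed operators depend only on the double coset
    (∀ (X Y : UltraUrysohn.FinSub U) (g h₁ h₂ : U ≃ᵢ U),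
      h₁ ∈ UltraUrysohn.pointStabilizer X → h₂ ∈ UltraUrysohn.pointStabilizer Y →
        ρ.compress X Y (h₂ * g * h₁) = ρ.compress X Y g) ∧
    -- double cosets are identified with morphisms of the amalgamation category
    ∃ e : ∀ X Y : UltraUrysohn.FinSub U, UltraUrysohn.Cosets X Y ≃ (hU.obj X ⟶ hU.obj Y),
      (∀ X Y g, e X Y (DoubleCoset.mk _ _ g) = hU.mor X Y g) ∧
      -- the compressed operators as functions of morphisms
      ∃ ρhat : ∀ X Y : UltraUrysohn.FinSub U,
          (hU.obj X ⟶ hU.obj Y) → (ρ.fixed X →L[ℂ] ρ.fixed Y),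
        (∀ X Y g, ρhat X Y (hU.mor X Y g) = ρ.compress X Y g) ∧
        -- multiplicativity
        (∀ X Y Z (p : hU.obj X ⟶ hU.obj Y) (q : hU.obj Y ⟶ hU.obj Z),
          ρhat Y Z q ∘L ρhat X Y p = ρhat X Z (p ≫ q)) ∧
        -- contractivity
        (∀ X Y (p : hU.obj X ⟶ hU.obj Y), ‖ρhat X Y p‖ ≤ 1) ∧
        -- compatibility with the involution
        (∀ X Y (p : hU.obj X ⟶ hU.obj Y),
          ContinuousLinearMap.adjoint (ρhat X Y p) = ρhat Y X (UltraUrysohn.involution p)) ∧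
        -- continuity from the quotient topology to the weak operator topology
        (∀ X Y, Continuous fun c : UltraUrysohn.Cosets X Y =>
          (ContinuousLinearMapWOT.ofCLM (ρhat X Y (e X Y c)) :
            ρ.fixed X →WOT[ℂ] ρ.fixed Y)) ∧
        -- non-degeneracy
        (∀ X, ρhat X X (𝟙 (hU.obj X)) = ContinuousLinearMap.id ℂ (ρ.fixed X)) := by
  -- The function on morphisms is defined through an arbitrary representative `r X Y p`; `hρ`
  -- records that the choice is immaterial.
  choose r hr using fun X Y : UltraUrysohn.FinSub U => hU.mor_surjective X Y
  have hρ : ∀ X Y g, ρ.compress X Y (r X Y (hU.mor X Y g)) = ρ.compress X Y g :=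
    fun X Y g => hU.compress_eq_of_mor_eq ρ (hr X Y _)
  refine ⟨fun X Y g h₁ h₂ hh₁ hh₂ => ρ.compress_mul_mul g hh₂ hh₁, hU.cosetEquiv,
    hU.cosetEquiv_mk, fun X Y p => ρ.compress X Y (r X Y p), hρ, fun X Y Z p q => ?_,
    fun X Y p => ρ.norm_compress_le X Y _, fun X Y p => ?_, fun X Y => ?_, fun X => ?_⟩
  · exact hU.compress_comp_compress ρ (by rw [hr, hr, hr])
  · obtain ⟨g, rfl⟩ := hU.mor_surjective X Y p
    simp only [hU.involution_mor, hρ, ρ.adjoint_compress]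
  -- Continuity on the quotient is tested on the group, and weak operator continuity on single
  -- matrix coefficients.
  · refine continuous_coinduced_dom.2 (ContinuousLinearMapWOT.continuous_iff.2 fun ξ η => ?_)
    refine (ρ.continuous_inner_compress ξ η).congr fun g => ?_
    exact congrArg (fun A : ρ.fixed X →L[ℂ] ρ.fixed Y => inner ℂ η (A ξ)) (hρ X Y g).symm
  · simp only [← hU.mor_one, hρ, ρ.compress_one]
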